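/- Let $\lambda, m, d$ be positive integers and let $n = m\lambda$. Let $S_n^\lambda$ be the set of all arrangements $(x_1,\dots,x_n)$ of the multiset in which each of the symbols $1,\dots,m$ appears exactly $\lambda$ times. A $(\lambda,n,d)$-frequency permutation array (under the $\ell_\infty$ distance) is a subset $C\subseteq S_n^\lambda$ such that $\max_{1\le i\le n}|x_i-y_i|\ge d$ for any two distinct $x,y\in C$. Let $F_\infty(\lambda,n,d)$ be the largest cardinality of a $(\lambda,n,d)$-frequency permutation array. Then \[ \frac{n!}{\left[(2d\lambda-\lambda)!\right]^{\frac{n}{2d\lambda-\lambda}}} \;\le\; F_\infty(\lambda,n,d)\;\le\; \frac{2^{2\lambda\lfloor (d-1)/2\rfloor}\, n^n}{\left(2\lambda\lfloor (d-1)/2\rfloor+\lambda\right)^n}. \] -/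

import Mathlib

open scoped Nat

/-- The multiset `{1, …, 1, 2, …, 2, …, m, …, m}` in which each of the symbols `1, …, m`
appears exactly `lam` times. -/
def freqMultiset (lam m : ℕ) : Multiset ℕ :=
  ∑ s ∈ Finset.Icc 1 m, Multiset.replicate lam s

/-- The set `S_n^lam` of all permutations `(x_1, …, x_n)` of the multiset in which each of the
symbols `1, …, n / lam` appears exactly `lam` times (for `n` a multiple of `lam`). -/
def freqPerm (lam n : ℕ) : Set (Fin n → ℕ) :=
  {x | Multiset.map x Finset.univ.val = freqMultiset lam (n / lam)}

/-- The distance `max_i |x_i - y_i|` between two vectors of natural numbers. -/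
def lInfDist {n : ℕ} (x y : Fin n → ℕ) : ℕ :=
  Finset.univ.sup fun i => ((x i : ℤ) - (y i : ℤ)).natAbs

/-- `C` is a `(lam, n, d)`-frequency permutation array under the `ℓ_∞` distance. -/
def IsFPA (lam n d : ℕ) (C : Finset (Fin n → ℕ)) : Prop :=
  (∀ x ∈ C, x ∈ freqPerm lam n) ∧ ∀ x ∈ C, ∀ y ∈ C, x ≠ y → d ≤ lInfDist x y

/-- `F_∞(lam, n, d)`: the largest cardinality of a `(lam, n, d)`-frequency permutation array
under the `ℓ_∞` distance. -/
noncomputable def maxFPA (lam n d : ℕ) : ℕ :=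
  sSup {k | ∃ C : Finset (Fin n → ℕ), IsFPA lam n d C ∧ C.card = k}

theorem freqPerm_finite (lam n : ℕ) : (freqPerm lam n).Finite := by
  refine Set.Finite.subset
    (Set.Finite.pi' (fun _ : Fin n => (freqMultiset lam (n / lam)).toFinset.finite_toSet)) ?_
  intro x hx i
  have hx' : Multiset.map x Finset.univ.val = freqMultiset lam (n / lam) := hx
  simp only [Finset.mem_coe, Multiset.mem_toFinset, ← hx']
  exact Multiset.mem_map_of_mem x (Finset.mem_univ i)

/-- The supremum in `maxFPA` is a genuine maximum. -/
theorem isGreatest_maxFPA (lam n d : ℕ) :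
    IsGreatest {k | ∃ C : Finset (Fin n → ℕ), IsFPA lam n d C ∧ C.card = k}
      (maxFPA lam n d) := by
  have hb : BddAbove {k | ∃ C : Finset (Fin n → ℕ), IsFPA lam n d C ∧ C.card = k} := by
    refine ⟨(freqPerm_finite lam n).toFinset.card, ?_⟩
    rintro k ⟨C, hC, rfl⟩
    exact Finset.card_le_card fun x hx => (freqPerm_finite lam n).mem_toFinset.2 (hC.1 x hx)
  have hne : {k | ∃ C : Finset (Fin n → ℕ), IsFPA lam n d C ∧ C.card = k}.Nonempty :=
    ⟨0, ∅, by simp [IsFPA], rfl⟩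
  exact ⟨Nat.sSup_mem hne hb, fun k hk => le_csSup hb hk⟩

/-! Lower bound: balls of radius `d - 1` around a maximum code cover all arrangements. Counted by
permutations `σ`, the ball around `c` is the permanent of the zero-one matrix marking the pairs with
`|c i - c j| ≤ d - 1`. Its row sums are at most `(2d - 1)λ`, so Bregman's theorem
(`log_card_matchings_le`) bounds it.

Upper bound: for `r = ⌊(d - 1) / 2⌋`, balls of radius `r` around codewords are disjoint in the
larger space of all `m ^ n` words. There a ball is a box with side `2r + 1`, except at the at most
`2r` symbols near the ends of `1, …, m`, which lose at most a factor 2 each time they occur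
(`prod_card_Icc_ge`). If `m ≤ 2r`, a code has at most one word and the bound is an elementary
inequality (`pow_le_two_pow_mul_pow`). -/

/-! ### Bregman's bound on permanents, by Schrijver's convexity argument -/

section Bregman

/-- `log ((r!)^{1/r})`. -/
noncomputable def logFactorialRoot (r : ℕ) : ℝ := Real.log (r ! : ℝ) / r

theorem mul_logFactorialRoot (r : ℕ) : (r : ℝ) * logFactorialRoot r = Real.log (r ! : ℝ) := by
  rcases Nat.eq_zero_or_pos r with rfl | h
  · simp
  · unfold logFactorialRoot
    field_simp

theorem logFactorialRoot_pred (r : ℕ) (hr : 0 < r) :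
    Real.log r + ((r : ℝ) - 1) * logFactorialRoot (r - 1) = r * logFactorialRoot r := by
  obtain ⟨k, rfl⟩ : ∃ k, r = k + 1 := ⟨r - 1, by omega⟩
  rw [mul_logFactorialRoot, Nat.factorial_succ]
  push_cast
  rw [Real.log_mul (by positivity) (by positivity), ← mul_logFactorialRoot]
  simp

theorem logFactorialRoot_mono : Monotone logFactorialRoot := by
  refine monotone_nat_of_le_succ fun r => ?_
  rcases Nat.eq_zero_or_pos r with rfl | h
  · simp [logFactorialRoot]
  · have hle : Real.log (r ! : ℝ) ≤ r * Real.log ((r + 1 : ℕ) : ℝ) := by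
      rw [← Real.log_pow]
      apply Real.log_le_log (by positivity)
      exact_mod_cast (Nat.factorial_le_pow r).trans (Nat.pow_le_pow_left (Nat.le_succ r) r)
    unfold logFactorialRoot
    rw [div_le_div_iff₀ (by positivity) (by positivity), Nat.factorial_succ]
    push_cast at hle ⊢
    rw [Real.log_mul (by positivity) (by positivity)]
    nlinarith

/-- Convexity of `t ↦ t log t`, summed over a finite set. -/
theorem sum_mul_log_sum_le {ι : Type*} (s : Finset ι) (t : ι → ℝ) (ht : ∀ i ∈ s, 0 ≤ t i) :
    (∑ i ∈ s, t i) * Real.log (∑ i ∈ s, t i) ≤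
      (∑ i ∈ s, t i) * Real.log s.card + ∑ i ∈ s, t i * Real.log (t i) := by
  rcases s.eq_empty_or_nonempty with rfl | hs
  · simp
  have hc : (0 : ℝ) < s.card := by exact_mod_cast hs.card_pos
  rcases (Finset.sum_nonneg ht).eq_or_lt with h0 | hpos
  · have hz := (Finset.sum_eq_zero_iff_of_nonneg ht).1 h0.symm
    rw [← h0, Finset.sum_eq_zero fun i hi => by rw [hz i hi, zero_mul]]
    simp
  have key := Real.convexOn_mul_log.map_sum_le (t := s) (w := fun _ => (s.card : ℝ)⁻¹) (p := t)
    (fun _ _ => by positivity) (by simp [hc.ne']) (fun i hi => ht i hi)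
  simp only [smul_eq_mul, ← Finset.mul_sum] at key
  rw [Real.log_mul (by positivity) hpos.ne', Real.log_inv, mul_assoc] at key
  have := le_of_mul_le_mul_left key (by positivity)
  linarith

open Classical in
/-- Bijections compatible with a relation: the permanent of a zero-one matrix. -/
noncomputable def matchings {α β : Type} [Fintype α] [Fintype β] (A : α → β → Prop) :
    Finset (α ≃ β) :=
  Finset.univ.filter fun e => ∀ i, A i (e i)

open Classical in
/-- The row sum of a zero-one matrix. -/
noncomputable def rowSum {α β : Type} [Fintype β] (A : α → β → Prop) (i : α) : ℕ :=
  (Finset.univ.filter (A i)).card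

open Classical in
theorem card_matchings_filter_le {α β : Type} [Fintype α] [Fintype β]
    (A : α → β → Prop) (i : α) (k : β) :
    ((matchings A).filter fun e => e i = k).card ≤
      (matchings fun (x : {x // x ≠ i}) (y : {y // y ≠ k}) => A x y).card := by
  rw [← Fintype.card_coe, ← Fintype.card_coe]
  have hmem : ∀ e : (matchings A).filter fun e => e i = k, (∀ x, A x (e.1 x)) ∧ e.1 i = k :=
    fun e => by simpa [matchings] using e.2
  refine Fintype.card_le_of_injective (fun e => ⟨e.1.subtypeEquiv fun a => by
    exact not_congr (e.1.injective.eq_iff.symm.trans (by rw [(hmem e).2])), ?_⟩) ?_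
  · simp only [matchings, Finset.mem_filter, Finset.mem_univ, true_and]
    exact fun x => (hmem e).1 x
  · intro e f hef
    ext x
    by_cases hx : x = i
    · rw [hx, (hmem e).2, (hmem f).2]
    · exact congrArg Subtype.val (Equiv.congr_fun (congrArg Subtype.val hef) ⟨x, hx⟩)

open Classical in
theorem rowSum_delete {α β : Type} [Fintype β] (A : α → β → Prop) (i : α) (k : β)
    (j : {x // x ≠ i}) :
    rowSum (fun (x : {x // x ≠ i}) (y : {y // y ≠ k}) => A x y) j =
      if A j k then rowSum A j - 1 else rowSum A j := by
  have h : rowSum (fun (x : {x // x ≠ i}) (y : {y // y ≠ k}) => A x y) j =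
      ((Finset.univ.filter (A j)).erase k).card := by
    unfold rowSum
    rw [← Finset.card_map (Function.Embedding.subtype _)]
    congr 1
    ext y
    simp [and_comm]
  rw [h, Finset.card_erase_eq_ite]
  simp [rowSum]

-- As `i` varies, `e i` runs over all columns, so row `j` loses a one for exactly `rowSum A j` of
-- them. The deletion `i = j` is excluded, and `logFactorialRoot_pred` absorbs the difference
-- against `log (rowSum A j)`.
open Classical in
theorem sum_logFactorialRoot_delete {α β : Type} [Fintype α] [Fintype β] (A : α → β → Prop)
    (e : α ≃ β) (he : ∀ i, A i (e i)) :
    ∑ i, (Real.log (rowSum A i) + ∑ j : {x // x ≠ i},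
      logFactorialRoot (rowSum (fun (x : {x // x ≠ i}) (y : {y // y ≠ e i}) => A x y) j)) =
    Fintype.card α * ∑ i, logFactorialRoot (rowSum A i) := by
  set h : α → β → ℝ := fun j k =>
    if A j k then logFactorialRoot (rowSum A j - 1) else logFactorialRoot (rowSum A j) with hh
  have h1 : ∀ i, ∑ j : {x // x ≠ i},
      logFactorialRoot (rowSum (fun (x : {x // x ≠ i}) (y : {y // y ≠ e i}) => A x y) j) =
      ∑ j, h j (e i) - h i (e i) := by
    intro i
    simp only [rowSum_delete, hh]
    rw [← Finset.sum_erase_eq_sub (Finset.mem_univ i)]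
    rw [Finset.sum_subtype (p := fun x => x ≠ i) (Finset.univ.erase i) (by simp)]
    exact Finset.sum_congr rfl fun j _ => by split_ifs <;> rfl
  have h2 : ∀ j, ∑ i, h j (e i) = rowSum A j * logFactorialRoot (rowSum A j - 1) +
      (Fintype.card α - rowSum A j) * logFactorialRoot (rowSum A j) := by
    intro j
    rw [Equiv.sum_comp e (h j)]
    simp only [hh]
    rw [Finset.sum_ite, Finset.sum_const, Finset.sum_const, nsmul_eq_mul, nsmul_eq_mul]
    have := Finset.card_filter_add_card_filter_not (s := (Finset.univ : Finset β)) (A j)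
    rw [Finset.card_univ, ← Fintype.card_congr e] at this
    rw [← this]
    simp [rowSum]
  simp only [h1]
  rw [Finset.sum_add_distrib, Finset.sum_sub_distrib, Finset.sum_comm]
  simp only [h2]
  rw [← Finset.sum_sub_distrib, ← Finset.sum_add_distrib, Finset.mul_sum]
  refine Finset.sum_congr rfl fun j _ => ?_
  have hr : 0 < rowSum A j := Finset.card_pos.2 ⟨e j, by simp [he j]⟩
  have := logFactorialRoot_pred _ hr
  simp only [hh, he j, if_true]
  linarith

open Classical in
/-- **Bregman's theorem** (Minc's conjecture), in logarithmic form. -/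
theorem log_card_matchings_le (n : ℕ) : ∀ {α β : Type} [Fintype α] [Fintype β]
    (A : α → β → Prop), Fintype.card α = n →
    Real.log (matchings A).card ≤ ∑ i, logFactorialRoot (rowSum A i) := by
  induction n with
  | zero =>
    intro α β _ _ A hα
    have : IsEmpty α := Fintype.card_eq_zero_iff.1 hα
    have h1 : (matchings A).card ≤ 1 := Finset.card_le_one.2 fun e _ f _ => by
      ext x; exact isEmptyElim x
    rw [Finset.univ_eq_empty, Finset.sum_empty]
    exact Real.log_nonpos (by positivity) (by exact_mod_cast h1)
  | succ n ih =>
    intro α β _ _ A hα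
    have hnonneg : 0 ≤ ∑ i, logFactorialRoot (rowSum A i) :=
      Finset.sum_nonneg fun i _ => by unfold logFactorialRoot; positivity
    -- With no matchings, `Real.log 0 = 0`, so only nonnegativity of the right side is needed.
    rcases Nat.eq_zero_or_pos (matchings A).card with h0 | hpos
    · rw [h0]; simpa using hnonneg
    set N : ℝ := ((matchings A).card : ℝ) with hN
    have hNpos : 0 < N := by rw [hN]; exact_mod_cast hpos
    -- Expand along row `i`, apply convexity to the fibre sizes, and bound the log of each fibre by
    -- induction. Weighting by fibre size turns the sum over columns into a sum over matchings.
    have row : ∀ i, N * Real.log N ≤ ∑ e ∈ matchings A, (Real.log (rowSum A i) +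
        ∑ j : {x // x ≠ i},
          logFactorialRoot (rowSum (fun (x : {x // x ≠ i}) (y : {y // y ≠ e i}) => A x y) j)) := by
      intro i
      have hmaps : ∀ e ∈ matchings A, e i ∈ Finset.univ.filter (A i) := fun e he => by
        simp only [matchings, Finset.mem_filter, Finset.mem_univ, true_and] at he ⊢
        exact he i
      have hsum : N = ∑ k ∈ Finset.univ.filter (A i),
          (((matchings A).filter fun e => e i = k).card : ℝ) := by
        rw [hN, Finset.card_eq_sum_card_fiberwise hmaps]
        push_cast; rfl
      have key := sum_mul_log_sum_le (Finset.univ.filter (A i))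
        (fun k => (((matchings A).filter fun e => e i = k).card : ℝ)) (fun _ _ => by positivity)
      rw [← hsum] at key
      refine key.trans ?_
      rw [Finset.sum_add_distrib, Finset.sum_const, nsmul_eq_mul]
      refine add_le_add le_rfl ?_
      rw [← Finset.sum_fiberwise_of_maps_to hmaps]
      refine Finset.sum_le_sum fun k _ => ?_
      rw [← nsmul_eq_mul, ← Finset.sum_const]
      refine Finset.sum_le_sum fun e he => ?_
      obtain ⟨_, rfl⟩ := Finset.mem_filter.1 he
      refine (Real.log_le_log ?_ ?_).trans (ih _ ?_)
      · exact_mod_cast Finset.card_pos.2 ⟨e, he⟩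
      · exact_mod_cast card_matchings_filter_le A i (e i)
      · rw [Fintype.card_subtype_compl, hα]; simp
    have total := Finset.sum_le_sum fun i (_ : i ∈ (Finset.univ : Finset α)) => row i
    rw [Finset.sum_comm, Finset.sum_const, Finset.card_univ, nsmul_eq_mul] at total
    rw [Finset.sum_congr (rfl : matchings A = _) fun e he => sum_logFactorialRoot_delete A e
      (Finset.mem_filter.1 he).2, Finset.sum_const, nsmul_eq_mul, hα, ← hN] at total
    have hn : (0 : ℝ) < ((n + 1 : ℕ) : ℝ) := by positivity
    refine le_of_mul_le_mul_left (a := ((n + 1 : ℕ) : ℝ) * N) ?_ (by positivity)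
    linarith

/-- A zero-one matrix with all row sums at most `R` has permanent at most `(R!)^{n/R}`. -/
theorem card_matchings_le_rpow {α β : Type} [Fintype α] [Fintype β] (A : α → β → Prop) (R : ℕ)
    (hR : ∀ i, rowSum A i ≤ R) :
    ((matchings A).card : ℝ) ≤ (R ! : ℝ) ^ ((Fintype.card α : ℝ) / R) := by
  rcases Nat.eq_zero_or_pos (matchings A).card with h0 | hpos
  · rw [h0]; push_cast; positivity
  rw [← Real.log_le_log_iff (by exact_mod_cast hpos) (by positivity),
    Real.log_rpow (by positivity)]
  calc _ ≤ ∑ i, logFactorialRoot (rowSum A i) := log_card_matchings_le _ A rfl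
    _ ≤ ∑ _i : α, logFactorialRoot R := Finset.sum_le_sum fun i _ => logFactorialRoot_mono (hR i)
    _ = _ := by
      rw [Finset.sum_const, Finset.card_univ, nsmul_eq_mul, logFactorialRoot]; ring

end Bregman

/-! ### Arrangements of the multiset -/

section FrequencyPermutations

theorem count_freqMultiset (lam m s : ℕ) :
    (freqMultiset lam m).count s = if s ∈ Finset.Icc 1 m then lam else 0 := by
  simp [freqMultiset, Multiset.count_sum', Multiset.count_replicate]

theorem card_filter_eq_of_mem_freqPerm {lam n : ℕ} {x : Fin n → ℕ} (hx : x ∈ freqPerm lam n)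
    (s : ℕ) : (Finset.univ.filter fun i => x i = s).card =
      if s ∈ Finset.Icc 1 (n / lam) then lam else 0 := by
  have hx' : Multiset.map x Finset.univ.val = freqMultiset lam (n / lam) := hx
  rw [← count_freqMultiset, ← hx', Multiset.count_map, Finset.card_def, Finset.filter_val]
  simp only [eq_comm]

theorem mem_Icc_of_mem_freqPerm {lam n : ℕ} {x : Fin n → ℕ} (hx : x ∈ freqPerm lam n)
    (i : Fin n) : x i ∈ Finset.Icc 1 (n / lam) := by
  by_contra h
  have := card_filter_eq_of_mem_freqPerm hx (x i)
  rw [if_neg h, Finset.card_eq_zero] at this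
  simpa using Finset.eq_empty_iff_forall_notMem.1 this i

theorem comp_perm_mem_freqPerm {lam n : ℕ} {x : Fin n → ℕ} (hx : x ∈ freqPerm lam n)
    (σ : Equiv.Perm (Fin n)) : x ∘ σ ∈ freqPerm lam n := by
  have hx' : Multiset.map x Finset.univ.val = freqMultiset lam (n / lam) := hx
  show Multiset.map (x ∘ σ) Finset.univ.val = _
  rw [← hx', ← Multiset.map_map]
  congr 1
  exact Multiset.map_univ_val_equiv σ

theorem exists_perm_of_mem_freqPerm {lam n : ℕ} {x y : Fin n → ℕ} (hx : x ∈ freqPerm lam n)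
    (hy : y ∈ freqPerm lam n) : ∃ σ : Equiv.Perm (Fin n), y = x ∘ σ := by
  have hcard : ∀ s, Fintype.card {i // y i = s} = Fintype.card {i // x i = s} := fun s => by
    rw [Fintype.card_subtype, Fintype.card_subtype, card_filter_eq_of_mem_freqPerm hx,
      card_filter_eq_of_mem_freqPerm hy]
  refine ⟨(Equiv.sigmaFiberEquiv y).symm.trans ((Equiv.sigmaCongrRight fun s =>
    Fintype.equivOfCardEq (hcard s)).trans (Equiv.sigmaFiberEquiv x)), ?_⟩
  ext i
  exact (Fintype.equivOfCardEq (hcard (y i)) ⟨i, rfl⟩).2.symm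

theorem freqPerm_nonempty {lam m n : ℕ} (hlam : 0 < lam) (hn : n = m * lam) :
    (freqPerm lam n).Nonempty := by
  have hcard : (freqMultiset lam (n / lam)).card = n := by
    simp [freqMultiset, hn, Nat.mul_div_cancel _ hlam]
  obtain ⟨l, hl⟩ := Quot.exists_rep (freqMultiset lam (n / lam))
  have hl' : (l : Multiset ℕ) = freqMultiset lam (n / lam) := hl
  rw [← hl', Multiset.coe_card] at hcard
  subst hcard
  refine ⟨l.get, ?_⟩
  show Multiset.map l.get Finset.univ.val = _
  rw [Fin.univ_val_map, List.ofFn_get, hl']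

theorem lInfDist_le_iff {n : ℕ} {x y : Fin n → ℕ} {r : ℕ} :
    lInfDist x y ≤ r ↔ ∀ i, x i ≤ y i + r ∧ y i ≤ x i + r := by
  simp only [lInfDist, Finset.sup_le_iff, Finset.mem_univ, true_implies]
  exact forall_congr' fun i => by omega

/-! ### Covering and the lower bound -/

theorem card_perm_near_le {lam n r : ℕ} {x : Fin n → ℕ} (hx : x ∈ freqPerm lam n) :
    ((Finset.univ.filter fun σ : Equiv.Perm (Fin n) => lInfDist x (x ∘ σ) ≤ r).card : ℝ) ≤
      (((2 * r + 1) * lam) ! : ℝ) ^ ((n : ℝ) / ((2 * r + 1) * lam : ℕ)) := by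
  classical
  have h := card_matchings_le_rpow (fun i j : Fin n => x i ≤ x j + r ∧ x j ≤ x i + r)
    ((2 * r + 1) * lam) (fun i => by
      have hmaps : ∀ j ∈ Finset.univ.filter fun j => x i ≤ x j + r ∧ x j ≤ x i + r,
          x j ∈ Finset.Icc (x i - r) (x i + r) := fun j hj => by
        simp only [Finset.mem_filter, Finset.mem_univ, true_and, Finset.mem_Icc] at hj ⊢
        omega
      unfold rowSum
      have := Finset.card_le_mul_card_image_of_maps_to hmaps lam (fun s _ => by
        refine (Finset.card_le_card (Finset.filter_subset_filter _ (Finset.subset_univ _))).trans ?_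
        rw [card_filter_eq_of_mem_freqPerm hx]
        split_ifs <;> simp)
      rw [Nat.card_Icc] at this
      rw [mul_comm (2 * r + 1)]
      refine le_trans (le_of_eq ?_) (this.trans (Nat.mul_le_mul_left lam
        (show x i + r + 1 - (x i - r) ≤ 2 * r + 1 by omega)))
      congr!)
  rw [Fintype.card_fin] at h
  refine le_trans (le_of_eq ?_) h
  congr 2
  ext σ
  simp [matchings, lInfDist_le_iff]

/-- The Gilbert–Varshamov bound. -/
theorem le_maxFPA {lam m n r : ℕ} (hlam : 0 < lam) (hn : n = m * lam) :
    (n ! : ℝ) / (((2 * r + 1) * lam) ! : ℝ) ^ ((n : ℝ) / ((2 * r + 1) * lam : ℕ)) ≤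
      maxFPA lam n (r + 1) := by
  classical
  obtain ⟨⟨C, hC, hcard⟩, hmax⟩ := isGreatest_maxFPA lam n (r + 1)
  obtain ⟨x, hx⟩ := freqPerm_nonempty hlam hn
  have hself : ∀ y : Fin n → ℕ, lInfDist y y ≤ r := fun y => lInfDist_le_iff.2 fun i => by omega
  have hsymm : ∀ y z : Fin n → ℕ, lInfDist y z = lInfDist z y := fun y z =>
    eq_of_forall_ge_iff fun s => by
      simp only [lInfDist_le_iff, and_comm]
  have hcover : ∀ y ∈ freqPerm lam n, ∃ c ∈ C, lInfDist c y ≤ r := by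
    intro y hy
    by_contra! hfar
    have hyC : y ∉ C := fun h => absurd (hself y) (not_le.2 (hfar y h))
    have : (insert y C).card ≤ maxFPA lam n (r + 1) := by
      refine hmax ⟨insert y C, ⟨?_, ?_⟩, rfl⟩
      · intro z hz
        rcases Finset.mem_insert.1 hz with rfl | hz
        exacts [hy, hC.1 z hz]
      · intro z hz w hw hzw
        rcases Finset.mem_insert.1 hz with rfl | hzC <;>
          rcases Finset.mem_insert.1 hw with rfl | hwC
        · exact absurd rfl hzw
        · rw [hsymm]; exact hfar w hwC
        · exact hfar z hzC
        · exact hC.2 z hzC w hwC hzw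
    rw [Finset.card_insert_of_notMem hyC, hcard] at this
    omega
  have hfact : (n ! : ℝ) = (Finset.univ : Finset (Equiv.Perm (Fin n))).card := by
    rw [Finset.card_univ, Fintype.card_perm, Fintype.card_fin]
  have hunion : (Finset.univ : Finset (Equiv.Perm (Fin n))) ⊆
      C.biUnion fun c => Finset.univ.filter fun σ => lInfDist c (x ∘ σ) ≤ r := by
    intro σ _
    obtain ⟨c, hc, hle⟩ := hcover _ (comp_perm_mem_freqPerm hx σ)
    exact Finset.mem_biUnion.2 ⟨c, hc, by simpa using hle⟩
  rw [div_le_iff₀ (by positivity), hfact, ← hcard, ← nsmul_eq_mul]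
  refine (Nat.cast_le.2 ((Finset.card_le_card hunion).trans Finset.card_biUnion_le)).trans ?_
  rw [Nat.cast_sum]
  refine Finset.sum_le_card_nsmul _ _ _ fun c hc => ?_
  refine le_trans (le_of_eq ?_) (card_perm_near_le (r := r) (hC.1 c hc))
  obtain ⟨τ, rfl⟩ := exists_perm_of_mem_freqPerm (hC.1 c hc) hx
  congr 1
  -- Since `x = c ∘ τ`, the word `x ∘ σ` is `c ∘ (τ * σ)`: recentre the ball at `c`.
  refine Finset.card_equiv (Equiv.mulLeft τ) fun σ => ?_
  simp only [Finset.mem_filter, Finset.mem_univ, true_and, Equiv.coe_mulLeft, Equiv.Perm.coe_mul]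
  rfl

/-! ### Packing and the upper bound -/

/-- The words over `{1, …, m}` within distance `r` of `x`. -/
def wordBall {n : ℕ} (m r : ℕ) (x : Fin n → ℕ) : Finset (Fin n → ℕ) :=
  Fintype.piFinset fun i => Finset.Icc (max 1 (x i - r)) (min m (x i + r))

/-- As `m ≥ 2r + 1`, an interval is clipped on one side at most, keeping at least `r + 1` points,
and `2(r + 1) ≥ 2r + 1`. -/
theorem prod_card_Icc_ge {m r : ℕ} (hm : 2 * r + 1 ≤ m) :
    (2 * r + 1) ^ m ≤ 2 ^ (2 * r) *
      ∏ s ∈ Finset.Icc 1 m, (Finset.Icc (max 1 (s - r)) (min m (s + r))).card := by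
  set B := (Finset.Icc 1 m).filter fun s => s ≤ r ∨ m < s + r with hB
  have hBcard : B.card ≤ 2 * r := by
    have hsub : B ⊆ Finset.Icc 1 r ∪ Finset.Ioc (m - r) m := fun s hs => by
      simp only [hB, Finset.mem_filter, Finset.mem_union, Finset.mem_Icc, Finset.mem_Ioc] at hs ⊢
      omega
    refine (Finset.card_le_card hsub).trans ((Finset.card_union_le _ _).trans ?_)
    simp only [Nat.card_Icc, Nat.card_Ioc]
    omega
  calc (2 * r + 1) ^ m = ∏ _s ∈ Finset.Icc 1 m, (2 * r + 1) := by simp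
    _ ≤ ∏ s ∈ Finset.Icc 1 m, (if s ≤ r ∨ m < s + r then 2 else 1) *
          (Finset.Icc (max 1 (s - r)) (min m (s + r))).card := by
        refine Finset.prod_le_prod' fun s hs => ?_
        rw [Finset.mem_Icc] at hs
        rw [Nat.card_Icc]
        split_ifs <;> omega
    _ = 2 ^ B.card * ∏ s ∈ Finset.Icc 1 m,
          (Finset.Icc (max 1 (s - r)) (min m (s + r))).card := by
        rw [Finset.prod_mul_distrib, ← Finset.prod_filter, Finset.prod_const]
    _ ≤ _ := Nat.mul_le_mul_right _ (Nat.pow_le_pow_right (by norm_num) hBcard)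

theorem card_wordBall_ge {lam n r : ℕ} {x : Fin n → ℕ} (hx : x ∈ freqPerm lam n)
    (hm : 2 * r + 1 ≤ n / lam) :
    (2 * r + 1) ^ (n / lam * lam) ≤
      2 ^ (2 * r * lam) * (wordBall (n / lam) r x).card := by
  have h : (wordBall (n / lam) r x).card = (∏ s ∈ Finset.Icc 1 (n / lam),
      (Finset.Icc (max 1 (s - r)) (min (n / lam) (s + r))).card) ^ lam := by
    rw [wordBall, Fintype.card_piFinset, ← Finset.prod_pow,
      ← Finset.prod_fiberwise_of_maps_to (g := x) (t := Finset.Icc 1 (n / lam))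
        (fun i _ => mem_Icc_of_mem_freqPerm hx i)]
    refine Finset.prod_congr rfl fun s hs => ?_
    rw [Finset.prod_congr rfl fun i hi => by rw [(Finset.mem_filter.1 hi).2],
      Finset.prod_const, card_filter_eq_of_mem_freqPerm hx, if_pos hs]
  rw [h, pow_mul, pow_mul, ← mul_pow]
  exact Nat.pow_le_pow_left (prod_card_Icc_ge hm) lam

/-- The sphere packing bound in the space of all words over `{1, …, m}`. -/
theorem card_mul_pow_le {lam m n d r : ℕ} (hlam : 0 < lam) (hn : n = m * lam)
    (hr : 2 * r < d) (hm : 2 * r + 1 ≤ m) {C : Finset (Fin n → ℕ)} (hC : IsFPA lam n d C) :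
    C.card * (2 * r + 1) ^ n ≤ 2 ^ (2 * r * lam) * m ^ n := by
  classical
  have hdiv : n / lam = m := by rw [hn, Nat.mul_div_cancel _ hlam]
  have hdisj : (C : Set (Fin n → ℕ)).PairwiseDisjoint (wordBall m r) := by
    intro x hx y hy hxy
    refine Finset.disjoint_left.2 fun z hzx hzy => ?_
    refine absurd (hC.2 x hx y hy hxy) (not_le.2 (lt_of_le_of_lt (lInfDist_le_iff.2 ?_) hr))
    intro i
    have h1 := Fintype.mem_piFinset.1 hzx i
    have h2 := Fintype.mem_piFinset.1 hzy i
    rw [Finset.mem_Icc] at h1 h2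
    omega
  have hsub : C.biUnion (wordBall m r) ⊆ Fintype.piFinset fun _ => Finset.Icc 1 m := by
    intro z hz
    obtain ⟨x, _, hzx⟩ := Finset.mem_biUnion.1 hz
    refine Fintype.mem_piFinset.2 fun i => ?_
    have := Fintype.mem_piFinset.1 hzx i
    rw [Finset.mem_Icc] at this ⊢
    omega
  have hle := Finset.card_le_card hsub
  rw [Finset.card_biUnion hdisj, Fintype.card_piFinset] at hle
  simp only [Nat.card_Icc, Nat.add_sub_cancel, Finset.prod_const, Finset.card_univ,
    Fintype.card_fin] at hle
  calc C.card * (2 * r + 1) ^ n = ∑ _x ∈ C, (2 * r + 1) ^ n := by simp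
    _ ≤ ∑ x ∈ C, 2 ^ (2 * r * lam) * (wordBall m r x).card := by
        refine Finset.sum_le_sum fun x hx => ?_
        have := card_wordBall_ge (r := r) (hC.1 x hx) (by rw [hdiv]; exact hm)
        rwa [hdiv, ← hn] at this
    _ ≤ _ := by rw [← Finset.mul_sum]; exact Nat.mul_le_mul_left _ hle

theorem card_le_one_of_le {lam m n d : ℕ} (hlam : 0 < lam) (hn : n = m * lam) (hd : 0 < d)
    (hm : m ≤ d) {C : Finset (Fin n → ℕ)} (hC : IsFPA lam n d C) : C.card ≤ 1 := by
  refine Finset.card_le_one.2 fun x hx y hy => ?_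
  by_contra hxy
  have hlt : lInfDist x y ≤ d - 1 := lInfDist_le_iff.2 fun i => by
    have h1 := mem_Icc_of_mem_freqPerm (hC.1 x hx) i
    have h2 := mem_Icc_of_mem_freqPerm (hC.1 y hy) i
    rw [hn, Nat.mul_div_cancel _ hlam, Finset.mem_Icc] at h1 h2
    omega
  have := hC.2 x hx y hy hxy
  omega

/-- The inequality `(a/m)^m ≤ 2^{a-1}` with `a = 2r+1 > m`. -/
theorem pow_le_two_pow_mul_pow {m r : ℕ} (hm : 0 < m) (hr : m ≤ 2 * r) :
    ((2 * r + 1 : ℕ) : ℝ) ^ m ≤ 2 ^ (2 * r) * (m : ℝ) ^ m := by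
  set a : ℝ := ((2 * r + 1 : ℕ) : ℝ) with ha
  have ha3 : (3 : ℝ) ≤ a := by
    rw [ha]; exact_mod_cast (by omega : 3 ≤ 2 * r + 1)
  have hm' : (0 : ℝ) < m := by exact_mod_cast hm
  have he := Real.exp_one_gt_d9
  have h2 := Real.log_two_gt_d9
  -- This is `log t ≤ t / e` at `t = a / m`.
  have hlog : m * Real.log (a / m) ≤ a / Real.exp 1 := by
    have h := Real.log_le_sub_one_of_pos (x := a / m / Real.exp 1) (by positivity)
    rw [Real.log_div (by positivity) (by positivity), Real.log_exp] at h
    calc m * Real.log (a / m) ≤ m * (a / m / Real.exp 1) := by gcongr; linarith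
      _ = _ := by field_simp
  have hbound : a / Real.exp 1 ≤ (a - 1) * Real.log 2 := by
    rw [div_le_iff₀ (by positivity)]
    -- Any constant from 1.5 up to `e log 2 ≈ 1.88` would do, as `a ≤ 1.5 (a - 1)` for `a ≥ 3`.
    have : (1.8 : ℝ) ≤ Real.log 2 * Real.exp 1 := by nlinarith
    nlinarith
  rw [← div_le_iff₀ (by positivity), ← div_pow,
    ← Real.log_le_log_iff (by positivity) (by positivity), Real.log_pow, Real.log_pow]
  refine (hlog.trans hbound).trans (le_of_eq ?_)
  rw [ha]; push_cast; ring

theorem maxFPA_mul_pow_le {lam m n d r : ℕ} (hlam : 0 < lam) (hm : 0 < m) (hn : n = m * lam)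
    (hr : 2 * r < d) :
    (maxFPA lam n d : ℝ) * ((2 * r + 1 : ℕ) : ℝ) ^ n ≤ 2 ^ (2 * r * lam) * (m : ℝ) ^ n := by
  obtain ⟨⟨C, hC, hcard⟩, -⟩ := isGreatest_maxFPA lam n d
  rw [← hcard]
  rcases Nat.lt_or_ge m (2 * r + 1) with h | h
  · have h1 : (C.card : ℝ) ≤ 1 := by
      exact_mod_cast card_le_one_of_le hlam hn (by omega) (by omega) hC
    calc (C.card : ℝ) * ((2 * r + 1 : ℕ) : ℝ) ^ n ≤ 1 * ((2 * r + 1 : ℕ) : ℝ) ^ n := by gcongr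
      _ = (((2 * r + 1 : ℕ) : ℝ) ^ m) ^ lam := by rw [one_mul, hn, pow_mul]
      _ ≤ (2 ^ (2 * r) * (m : ℝ) ^ m) ^ lam := by
          gcongr; exact pow_le_two_pow_mul_pow hm (by omega)
      _ = _ := by rw [mul_pow, ← pow_mul, ← pow_mul, hn]
  · exact_mod_cast card_mul_pow_le hlam hn hr h hC

end FrequencyPermutations

theorem theorem2 (lam m n d : ℕ) (hlam : 0 < lam) (hm : 0 < m) (hn : n = m * lam)
    (hd : 0 < d) :
    (n ! : ℝ) / (((2 * d * lam - lam) ! : ℕ) : ℝ) ^ ((n : ℝ) / ((2 * d * lam - lam : ℕ) : ℝ))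
        ≤ (maxFPA lam n d : ℝ) ∧
      (maxFPA lam n d : ℝ) ≤
        (2 : ℝ) ^ (2 * lam * ((d - 1) / 2)) * (n : ℝ) ^ n
          / ((2 * lam * ((d - 1) / 2) + lam : ℕ) : ℝ) ^ n := by
  constructor
  · obtain ⟨r, rfl⟩ : ∃ r, d = r + 1 := ⟨d - 1, by omega⟩
    have hrow : 2 * (r + 1) * lam - lam = (2 * r + 1) * lam := by
      rw [Nat.sub_eq_iff_eq_add (by nlinarith)]; ring
    rw [hrow]
    exact le_maxFPA hlam hn
  · have h := maxFPA_mul_pow_le (d := d) (r := (d - 1) / 2) hlam hm hn (by omega)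
    generalize (d - 1) / 2 = r at h ⊢
    have hl : (0 : ℝ) < lam := by exact_mod_cast hlam
    have hk : ((2 * lam * r + lam : ℕ) : ℝ) = ((2 * r + 1 : ℕ) : ℝ) * lam := by push_cast; ring
    have hn' : (n : ℝ) = m * lam := by rw [hn]; push_cast; rfl
    rw [hk, hn', mul_pow, mul_pow, ← mul_assoc, mul_div_mul_right _ _ (by positivity),
      le_div_iff₀ (by positivity)]
    rwa [show 2 * lam * r = 2 * r * lam by ring]
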